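/- Ordinals are identified with the sets of their predecessors, a cardinal is identified with its initial ordinal, and all sums, products and powers of ordinals below are ordinal operations ($\lambda\kappa$ is the order type of $\kappa$ consecutive copies of $\lambda$). For an ordinal $\alpha$ and an ordinal $\gamma$ let $[\alpha]^\gamma$ be the set of subsets of $\alpha$ of order type $\gamma$. For ordinals $\alpha,\beta_0,\beta_1$ the relation $\alpha\longrightarrow(\beta_0,\beta_1)^2$ says that for every $f:[\alpha]^2\to\{0,1\}$ there are $i<2$ and $X\in[\alpha]^{\beta_i}$ such that $f$ is constant with value $i$ on $[X]^2$; $\alpha\not\longrightarrow(\beta_0,\beta_1)^2$ is its negation. For an infinite cardinal $\kappa$ let the unbounding number $\mathfrak b_\kappa$ be the least cardinality of a family $A$ of functions $\kappa\to\kappa$ such that for every $f:\kappa\to\kappa$ there is $g\in A$ with $|\{\alpha<\kappa : f(\alpha)<g(\alpha)\}|=\kappa$, and let the stick number $\mathrm{stick}(\kappa)$ be the least cardinality of a family $X\subseteq[\kappa^+]^{\kappa}$ such that every $y\in[\kappa^+]^{\kappa^+}$ has a subset $x\in X$. Write $\mathfrak b=\mathfrak b_{\aleph_0}$ and $\mathrm{stick}=\mathrm{stick}(\aleph_0)$.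 Corollary. If $\kappa$ is an infinite regular cardinal and $\lambda=\kappa^+=\mathfrak b_\kappa=\mathrm{stick}(\kappa)$, then $\alpha\not\longrightarrow(\lambda\kappa,4)^2$ for all ordinals $\alpha<\lambda^2\kappa$. In particular, if $\mathfrak b=\aleph_1=\mathrm{stick}$, then $\alpha\not\longrightarrow(\omega_1\omega,4)^2$ for all ordinals $\alpha<\omega_1^2\omega$. -/

import Mathlib

open Cardinal Ordinal

universe u

/-- `[α]^γ`: the set of all subsets of the ordinal `α` (viewed as the well-ordered type of its
predecessors) that have order type `γ`. -/
def subsetsOfType (α γ : Ordinal.{u}) : Set (Set α.ToType) :=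
  {X | typeLT X = γ}

/-- The ordinary partition relation `α ⟶ (β i : i < m)^k_m`: for every colouring `f` of the
`k`-element subsets of `α` with `m` colours there are a colour `i` and a set `X ⊆ α` of order type
`β i` such that every `k`-element subset of `X` has colour `i`. -/
def PartitionRel (α : Ordinal.{u}) (k : ℕ) {m : ℕ} (β : Fin m → Ordinal.{u}) : Prop :=
  ∀ f : {s : Finset α.ToType // s.card = k} → Fin m,
    ∃ i : Fin m, ∃ X ∈ subsetsOfType α (β i),
      ∀ s : {s : Finset α.ToType // s.card = k}, (s.1 : Set α.ToType) ⊆ X → f s = i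

/-- The unbounding number `𝔟_κ`: the least cardinality of a family `A` of functions `κ → κ` such
that for every `f : κ → κ` there is `g ∈ A` with `|{α < κ : f α < g α}| = κ`. -/
noncomputable def unboundingNumber (κ : Cardinal.{u}) : Cardinal.{u} :=
  sInf {c | ∃ A : Set (κ.ord.ToType → κ.ord.ToType),
    (∀ f : κ.ord.ToType → κ.ord.ToType, ∃ g ∈ A, #{a : κ.ord.ToType | f a < g a} = κ) ∧ #A = c}

/-- The two-parameter stick number (used for `κ ≤ lam`): the least cardinality of a family
`X ⊆ [lam]^κ` such that every `y ∈ [lam]^lam` includes some `x ∈ X`. -/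
noncomputable def stickNumber₂ (κ lam : Cardinal.{u}) : Cardinal.{u} :=
  sInf {c | ∃ X : Set (Set lam.ord.ToType), X ⊆ subsetsOfType lam.ord κ.ord ∧
    (∀ y ∈ subsetsOfType lam.ord lam.ord, ∃ x ∈ X, x ⊆ y) ∧ #X = c}

/-- The stick number of `κ`, that is, the two-parameter stick number of `κ` and `κ⁺`. -/
noncomputable def stickNumber (κ : Cardinal.{u}) : Cardinal.{u} :=
  stickNumber₂ κ (Order.succ κ)

/-! Write λ = κ⁺. Embed α in κ × λ × λ, ordered lexicographically, with bounded first coordinate,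
and give colour 1 to the edges of a graph inside each layer λ × λ, whose points are pairs (column,
height). The graph must have no 4-clique, yet have an edge inside any union of κ columns with λ
heights in each; every copy of λκ in α contains such a union (`exists_downEdge_of_lex`).

Edges run right and down. They are governed by a subadditive ρ : [λ]² → κ with small fibres
(`exists_subadditive`) and by sets N(z, c) of fewer than κ heights below z. The sets are built by
recursion on z so that, for b < c, members of N(z, b) and N(z, c) can be joined only if ρ(z, c) <
ρ(z, b). In a 4-clique these inequalities contradict subadditivity (`not_downEdge_clique_four`).

The stick hypothesis supplies λ guesses S(a) of size κ, and 𝔟 = λ supplies functions g(z) unbounded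
along every tail of z. Letting N(z, c) meet each S(a) ⊆ z with ρ(z, a) ≤ g(z)(ρ(z, c)) keeps it
small but makes it catch a guess inside a given column (`exists_downEdge`). -/

/-- Well-founded recursion for a property of `f b` that refers to the earlier values of `f`. -/
theorem exists_of_wellFounded_extend {ι : Type*} {γ : Type*} [Nonempty γ] {r : ι → ι → Prop}
    (wf : WellFounded r) (P : ι → (ι → γ) → γ → Prop)
    (congr : ∀ b f f' x, (∀ a, r a b → f a = f' a) → P b f x → P b f' x)
    (extend : ∀ b f, (∀ a, r a b → P a f (f a)) → ∃ x, P b f x) :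
    ∃ f : ι → γ, ∀ b, P b f (f b) := by
  classical
  obtain ⟨x₀⟩ := ‹Nonempty γ›
  let F : ∀ b, (∀ a, r a b → γ) → γ := fun b g =>
    if h : ∃ x, P b (fun a => if h : r a b then g a h else x₀) x then h.choose else x₀
  refine ⟨wf.fix F, fun b => ?_⟩
  induction b using wf.induction with
  | _ b ih =>
    obtain ⟨x, hx⟩ := extend b (wf.fix F) ih
    have hex : ∃ x, P b (fun a => if h : r a b then wf.fix F a else x₀) x :=
      ⟨x, congr _ _ _ _ (fun a h => by simp [h]) hx⟩
    have h1 : wf.fix F b = hex.choose := by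
      rw [wf.fix_eq]
      exact dif_pos hex
    rw [h1]
    exact congr _ _ _ _ (fun a h => by simp [h]) hex.choose_spec

theorem mk_biUnion_lt_of_isRegular {κ : Cardinal.{u}} (hκ : κ.IsRegular) {α β : Type u} {s : Set α}
    {t : α → Set β} (hs : #s < κ) (ht : ∀ a ∈ s, #(t a) < κ) : #(⋃ a ∈ s, t a : Set β) < κ :=
  (Cardinal.card_biUnion_lt_iff_forall_of_isRegular (t := fun a _ => t a) hκ hs).2 ht

/-- In a well-order of regular cardinality with small initial segments, small sets are bounded. -/
theorem exists_upper_bound_of_mk_lt {κ : Cardinal.{u}} (hκ : κ.IsRegular) {K : Type u}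
    [LinearOrder K] (hK : #K = κ) (hI : ∀ k : K, #(Set.Iic k) < κ) {s : Set K} (hs : #s < κ) :
    ∃ k, ∀ x ∈ s, x < k := by
  by_contra! h
  have h1 : (⋃ a ∈ s, Set.Iic a) = Set.univ := by
    ext k
    simpa using h k
  have h2 := mk_biUnion_lt_of_isRegular hκ hs (t := fun a => Set.Iic a) (fun a _ => hI a)
  rw [h1, mk_univ, hK] at h2
  exact h2.false

/-! ### Subadditive functions with small fibres -/

/-- The new row `r` = ρ(z, ·) goes through `t a`, the point of [a, z) with least `e`-value: r(a)
combines ρ(t a, a) with a bound `s (e (t a))` on all ρ-values among points of no larger `e`-value.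
-/
theorem exists_subadditive_extend {κ : Cardinal.{u}} (hκ : κ.IsRegular) {K L : Type u}
    [LinearOrder K] [WellFoundedLT K] (hK : #K = κ) (hI : ∀ k : K, #(Set.Iic k) < κ)
    [LinearOrder L] [WellFoundedLT L] (ρ : L → L → K) (z : L) (e : L → K)
    (he : Set.InjOn e (Set.Iio z))
    (h1 : ∀ c < z, ∀ a b, a < b → b < c → ρ c a ≤ max (ρ b a) (ρ c b))
    (h2 : ∀ c < z, ∀ a b, a < b → b < c → ρ b a ≤ max (ρ c a) (ρ c b))
    (h3 : ∀ c < z, ∀ k, #{a | a < c ∧ ρ c a ≤ k} < κ) :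
    ∃ r : L → K, (∀ a b, a < b → b < z → r a ≤ max (ρ b a) (r b)) ∧
      (∀ a b, a < b → b < z → ρ b a ≤ max (r a) (r b)) ∧ ∀ k, #{a | a < z ∧ r a ≤ k} < κ := by
  classical
  have hne : Nonempty K := by
    rw [← mk_ne_zero_iff, hK]
    exact hκ.pos.ne'
  have htop : ∀ a, a < z → ∃ t, (a ≤ t ∧ t < z) ∧ ∀ b, a ≤ b → b < z → e t ≤ e b := by
    intro a ha
    obtain ⟨t, ht, hmin⟩ := (wellFounded_lt.onFun (f := e)).has_min {b | a ≤ b ∧ b < z}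
      ⟨a, le_rfl, ha⟩
    exact ⟨t, ht, fun b hb hbz => not_lt.1 (hmin b ⟨hb, hbz⟩)⟩
  choose! t ht htmin using htop
  have hBne : ∀ i : K, ∃ x, i ≤ x ∧ ∀ b b', b < z → b' < z → e b ≤ i → e b' ≤ i → ρ b b' ≤ x := by
    intro i
    have hsmall : #{b | b < z ∧ e b ≤ i} < κ := by
      refine lt_of_le_of_lt ?_ (hI i)
      refine mk_le_of_injective (f := fun b => ⟨e b.1, b.2.2⟩) ?_
      intro b b' hbb
      exact Subtype.ext (he b.2.1 b'.2.1 (congrArg Subtype.val hbb))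
    have h4 : #(⋃ b ∈ {b | b < z ∧ e b ≤ i}, (ρ b '' {b | b < z ∧ e b ≤ i}) : Set K) < κ :=
      mk_biUnion_lt_of_isRegular hκ hsmall fun b _ => mk_image_le.trans_lt hsmall
    obtain ⟨x, hx⟩ := exists_upper_bound_of_mk_lt hκ hK hI h4
    refine ⟨max i x, le_max_left _ _, fun b b' hb hb' hi hi' => le_max_of_le_right (hx _ ?_).le⟩
    simp only [Set.mem_iUnion]
    exact ⟨b, ⟨hb, hi⟩, b', ⟨hb', hi'⟩, rfl⟩
  -- Taking the least bound makes `s` monotone.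
  have hmin : ∀ i : K, ∃ x, (i ≤ x ∧ ∀ b b', b < z → b' < z → e b ≤ i → e b' ≤ i → ρ b b' ≤ x) ∧
      ∀ y, (i ≤ y ∧ ∀ b b', b < z → b' < z → e b ≤ i → e b' ≤ i → ρ b b' ≤ y) → x ≤ y := by
    intro i
    obtain ⟨x, hx, hm⟩ := (wellFounded_lt (α := K)).has_min _ (hBne i)
    exact ⟨x, hx, fun y hy => not_lt.1 (hm y hy)⟩
  choose s hs hsmin using hmin
  have smono : Monotone s := fun i j hij => hsmin i _
    ⟨hij.trans (hs j).1, fun b b' hb hb' hi hi' => (hs j).2 b b' hb hb' (hi.trans hij)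
      (hi'.trans hij)⟩
  have key : ∀ a b, a < b → b < z → t a = t b ∨ (t a < b ∧ e (t a) ≤ e (t b)) := by
    intro a b hab hb
    have ha := hab.trans hb
    have hle : e (t a) ≤ e (t b) := htmin a ha _ (hab.le.trans (ht b hb).1) (ht b hb).2
    rcases lt_or_ge (t a) b with h | h
    · exact Or.inr ⟨h, hle⟩
    · exact Or.inl (he (ht a ha).2 (ht b hb).2 (hle.antisymm (htmin b hb _ h (ht a ha).2)))
  let r : L → K := fun a => if a = t a then s (e (t a)) else max (ρ (t a) a) (s (e (t a)))
  have rs : ∀ a, s (e (t a)) ≤ r a := by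
    intro a
    by_cases h : a = t a
    · simp only [r, if_pos h, le_refl]
    · simp only [r, if_neg h, le_max_right]
  have rρ : ∀ a, a < t a → ρ (t a) a ≤ r a := by
    intro a h
    simp only [r, if_neg h.ne, le_max_left]
  have rle : ∀ a x, a < z → s (e (t a)) ≤ x → (a < t a → ρ (t a) a ≤ x) → r a ≤ x := by
    intro a x ha h h'
    by_cases h0 : a = t a
    · simpa only [r, if_pos h0] using h
    · simpa only [r, if_neg h0] using max_le (h' (lt_of_le_of_ne (ht a ha).1 h0)) h
  have sρ : ∀ a b, a < z → b < z → e (t a) ≤ e (t b) → ρ (t b) (t a) ≤ s (e (t b)) :=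
    fun a b ha hb h => (hs (e (t b))).2 _ _ (ht b hb).2 (ht a ha).2 le_rfl h
  have ρr : ∀ a b, a < z → b < z → t a < b → e (t a) ≤ e (t b) → ρ b (t a) ≤ r b := by
    intro a b ha hb h hle
    rcases (ht b hb).1.eq_or_lt with h5 | h5
    · have := sρ a b ha hb hle
      rw [← h5] at this
      exact this.trans (by simpa [← h5] using rs b)
    · exact (h2 _ (ht b hb).2 (t a) b h h5).trans
        (max_le ((sρ a b ha hb hle).trans (rs b)) (rρ b h5))
  refine ⟨r, ?_, ?_, ?_⟩
  · intro a b hab hb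
    have ha := hab.trans hb
    rcases key a b hab hb with h | ⟨h, hle⟩
    · refine rle a _ ha (h ▸ le_max_of_le_right (rs b)) fun hat => ?_
      rcases (ht b hb).1.eq_or_lt with h5 | h5
      · rw [h, ← h5]; exact le_max_left _ _
      · rw [h]
        exact (h1 _ (ht b hb).2 a b hab h5).trans (max_le_max le_rfl (rρ b h5))
    · refine rle a _ ha (le_max_of_le_right ((smono hle).trans (rs b))) fun hat => ?_
      exact (h2 b hb a (t a) hat h).trans (max_le_max le_rfl (ρr a b ha hb h hle))
  · intro a b hab hb
    have ha := hab.trans hb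
    rcases key a b hab hb with h | ⟨h, hle⟩
    · rcases (ht b hb).1.eq_or_lt with h5 | h5
      · have h6 := rρ a (by rw [h, ← h5]; exact hab)
        rw [h, ← h5] at h6
        exact le_max_of_le_left h6
      · have h6 := rρ a (by rw [h]; exact hab.trans h5)
        rw [h] at h6
        exact (h2 _ (ht b hb).2 a b hab h5).trans (max_le_max h6 (rρ b h5))
    · have h6 := ρr a b ha hb h hle
      rcases (ht a ha).1.eq_or_lt with h5 | h5
      · rw [← h5] at h6
        exact le_max_of_le_right h6
      · exact (h1 b hb a (t a) h5 h).trans (max_le_max (rρ a h5) h6)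
  · intro k
    -- Since i ≤ `s i`, r(a) ≤ k forces e(t a) ≤ k, leaving fewer than κ values of `t a`, each with
    -- a small fibre.
    have hsmall : #{b | b < z ∧ e b ≤ k} < κ := by
      refine lt_of_le_of_lt ?_ (hI k)
      refine mk_le_of_injective (f := fun b => ⟨e b.1, b.2.2⟩) ?_
      intro b b' hbb
      exact Subtype.ext (he b.2.1 b'.2.1 (congrArg Subtype.val hbb))
    have h4 := mk_biUnion_lt_of_isRegular hκ hsmall
      (t := fun T => insert T {a | a < T ∧ ρ T a ≤ k}) fun T hT =>
        mk_insert_le.trans_lt (add_lt_of_lt hκ.aleph0_le (h3 T hT.1 k)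
          (one_lt_aleph0.trans_le hκ.aleph0_le))
    refine (mk_le_mk_of_subset ?_).trans_lt h4
    rintro a ⟨ha, hak⟩
    simp only [Set.mem_iUnion]
    refine ⟨t a, ⟨(ht a ha).2, (hs _).1.trans ((rs a).trans hak)⟩, ?_⟩
    rcases (ht a ha).1.eq_or_lt with h5 | h5
    · exact Or.inl h5
    · exact Or.inr ⟨h5, (rρ a h5).trans hak⟩

/-- A subadditive function `ρ : [κ⁺]² → κ` all of whose fibres are small; `ρ b a` is meant for
`a < b`. -/
theorem exists_subadditive {κ : Cardinal.{u}} (hκ : κ.IsRegular) {K L : Type u}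
    [LinearOrder K] [WellFoundedLT K] (hK : #K = κ) (hI : ∀ k : K, #(Set.Iic k) < κ)
    [LinearOrder L] [WellFoundedLT L] (hL : ∀ b : L, #(Set.Iio b) ≤ κ) :
    ∃ ρ : L → L → K, (∀ a b c, a < b → b < c → ρ c a ≤ max (ρ b a) (ρ c b)) ∧
      (∀ a b c, a < b → b < c → ρ b a ≤ max (ρ c a) (ρ c b)) ∧
      ∀ c k, #{a | a < c ∧ ρ c a ≤ k} < κ := by
  classical
  have hne : Nonempty K := by
    rw [← mk_ne_zero_iff, hK]
    exact hκ.pos.ne'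
  obtain ⟨ρ, hρ⟩ := exists_of_wellFounded_extend (γ := L → K) (wellFounded_lt (α := L))
    (fun z ρ r => (∀ a b, a < b → b < z → r a ≤ max (ρ b a) (r b)) ∧
      (∀ a b, a < b → b < z → ρ b a ≤ max (r a) (r b)) ∧ ∀ k, #{a | a < z ∧ r a ≤ k} < κ)
    (by
      rintro z ρ ρ' r h ⟨h1, h2, h3⟩
      refine ⟨fun a b hab hb => ?_, fun a b hab hb => ?_, h3⟩
      · rw [← h b hb]; exact h1 a b hab hb
      · rw [← h b hb]; exact h2 a b hab hb)
    (by
      intro z ρ h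
      obtain ⟨e⟩ : Nonempty (Set.Iio z ↪ K) := by
        rw [← Cardinal.le_def, hK]; exact hL z
      obtain ⟨k₀⟩ := hne
      refine exists_subadditive_extend hκ hK hI ρ z
        (fun b => if hb : b < z then e ⟨b, hb⟩ else k₀) ?_ ?_ ?_ ?_
      · intro b hb b' hb' hbb
        rw [Set.mem_Iio] at hb hb'
        simp only [dif_pos hb, dif_pos hb'] at hbb
        exact congrArg Subtype.val (e.injective hbb)
      · exact fun c hc => (h c hc).1
      · exact fun c hc => (h c hc).2.1
      · exact fun c hc => (h c hc).2.2)
  exact ⟨ρ, fun a b c hab hbc => (hρ c).1 a b hab hbc, fun a b c hab hbc => (hρ c).2.1 a b hab hbc,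
    fun c => (hρ c).2.2⟩

/-! ### The graph and its 4-cliques -/

/-- The neighbourhoods below height `z`, one set `p c` for each column `c < z`. -/
theorem exists_neighbours_extend {κ : Cardinal.{u}} (hκ : κ.IsRegular) {K L : Type u}
    [LinearOrder K] [WellFoundedLT K] [LinearOrder L] [WellFoundedLT L]
    (r g : L → K) (z : L) (hr : ∀ k, #{a | a < z ∧ r a ≤ k} < κ) (i : L → K)
    (hi : ∀ k, #{a | a < z ∧ i a ≤ k} < κ)
    (S : L → Set L) (hS : ∀ c, κ ≤ #(S c)) (N : L → L → Set L) (hN : ∀ d < z, ∀ c, #(N d c) < κ) :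
    ∃ p : L → Set L, (∀ c, #(p c) < κ) ∧ (∀ c, ∀ d ∈ p c, c < z ∧ d < z) ∧
      (∀ b c d e, b < c → d ∈ p b → e ∈ p c → e ∈ N d c → r c < r b) ∧
      ∀ c < z, ∀ a < z, i a ≤ g c → S a ⊆ Set.Iio z → (p c ∩ S a).Nonempty := by
  classical
  -- Columns are treated in order of (r c, c): fewer than κ precede any given one, so the heights
  -- they forbid cannot exhaust any S(a). A column b < c treated after c has r c < r b, the
  -- permitted case.
  obtain ⟨p, hp⟩ := exists_of_wellFounded_extend (γ := Set L)
    (r := fun b c => toLex (r b, b) < toLex (r c, c))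
    (InvImage.wf (fun b => toLex (r b, b)) wellFounded_lt)
    (fun c p x => #x < κ ∧ (∀ d ∈ x, c < z ∧ d < z) ∧
      (∀ b, b < z → toLex (r b, b) < toLex (r c, c) → ∀ d ∈ p b, ∀ e ∈ x, e ∉ N d c) ∧
      (c < z → ∀ a < z, i a ≤ g c → S a ⊆ Set.Iio z → (x ∩ S a).Nonempty))
    (by
      rintro c p p' x h ⟨h1, h2, h3, h4⟩
      exact ⟨h1, h2, fun b hb hbc => by rw [← h b hbc]; exact h3 b hb hbc, h4⟩)
    (by
      intro c p ih
      by_cases hc : c < z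
      swap
      · exact ⟨∅, by simpa using hκ.pos, by simp, by simp, fun h => absurd h hc⟩
      let B : Set L := {b | b < z ∧ toLex (r b, b) < toLex (r c, c)}
      have hB : #B < κ := by
        refine (mk_le_mk_of_subset ?_).trans_lt (hr (r c))
        rintro b ⟨hb, hbc⟩
        refine ⟨hb, ?_⟩
        rw [Prod.Lex.toLex_lt_toLex] at hbc
        rcases hbc with h | h
        · exact h.le
        · exact h.1.le
      let U : Set L := ⋃ b ∈ B, ⋃ d ∈ p b, N d c
      have hU : #U < κ := mk_biUnion_lt_of_isRegular hκ hB fun b hb =>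
        mk_biUnion_lt_of_isRegular hκ (ih b hb.2).1 fun d hd =>
          hN d ((ih b hb.2).2.1 d hd).2 c
      have hpick : ∀ a, ∃ d, d ∈ S a ∧ d ∉ U := by
        intro a
        by_contra! h
        exact ((mk_le_mk_of_subset (show S a ⊆ U from h)).trans_lt hU).not_ge (hS a)
      choose q hqS hqU using hpick
      refine ⟨q '' {a | (a < z ∧ i a ≤ g c) ∧ S a ⊆ Set.Iio z}, ?_, ?_, ?_, ?_⟩
      · exact mk_image_le.trans_lt ((mk_le_mk_of_subset fun a ha => ha.1).trans_lt (hi (g c)))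
      · rintro _ ⟨a, ha, rfl⟩
        exact ⟨hc, ha.2 (hqS a)⟩
      · rintro b hb hbc d hd _ ⟨a, ha, rfl⟩ hmem
        refine hqU a ?_
        simp only [U, Set.mem_iUnion]
        exact ⟨b, ⟨hb, hbc⟩, d, hd, hmem⟩
      · intro _ a ha hia hSa
        exact ⟨q a, ⟨a, ⟨⟨ha, hia⟩, hSa⟩, rfl⟩, hqS a⟩)
  refine ⟨p, fun c => (hp c).1, fun c => (hp c).2.1, ?_, fun c hc => (hp c).2.2.2 hc⟩
  intro b c d e hbc hd he heN
  by_contra! hle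
  refine (hp c).2.2.1 b ((hp b).2.1 d hd).1 ?_ d hd e he heN
  rw [Prod.Lex.toLex_lt_toLex]
  rcases hle.lt_or_eq with h | h
  · exact Or.inl h
  · exact Or.inr ⟨h, hbc⟩

theorem exists_neighbours {κ : Cardinal.{u}} (hκ : κ.IsRegular) {K L : Type u}
    [LinearOrder K] [WellFoundedLT K] [LinearOrder L] [WellFoundedLT L]
    (ρ : L → L → K) (hρ : ∀ c k, #{a | a < c ∧ ρ c a ≤ k} < κ) (g : L → K → K)
    (S : L → Set L) (hS : ∀ c, κ ≤ #(S c)) :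
    ∃ N : L → L → Set L, (∀ z b c d e, b < c → d ∈ N z b → e ∈ N z c → e ∈ N d c → ρ z c < ρ z b) ∧
      ∀ z, ∀ c < z, ∀ a < z, ρ z a ≤ g z (ρ z c) → S a ⊆ Set.Iio z →
        (N z c ∩ S a).Nonempty := by
  obtain ⟨N, h⟩ := exists_of_wellFounded_extend (γ := L → Set L) (wellFounded_lt (α := L))
    (fun z N p => (∀ c, #(p c) < κ) ∧ (∀ c, ∀ d ∈ p c, c < z ∧ d < z) ∧
      (∀ b c d e, b < c → d ∈ p b → e ∈ p c → e ∈ N d c → ρ z c < ρ z b) ∧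
      ∀ c < z, ∀ a < z, ρ z a ≤ g z (ρ z c) → S a ⊆ Set.Iio z → (p c ∩ S a).Nonempty)
    (by
      rintro z N N' p h ⟨h1, h2, h3, h4⟩
      refine ⟨h1, h2, fun b c d e hbc hd he heN => h3 b c d e hbc hd he ?_, h4⟩
      rw [h d (h2 b d hd).2]
      exact heN)
    (fun z N ih => exists_neighbours_extend hκ (ρ z) (fun c => g z (ρ z c)) z (hρ z) (ρ z) (hρ z)
      S hS N fun d hd => (ih d hd).1)
  exact ⟨N, fun z => (h z).2.2.1, fun z => (h z).2.2.2⟩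

/-- The graph on `L × L`, oriented to the right and downwards. -/
def DownEdge {K L : Type u} [LinearOrder K] [LinearOrder L] (ρ : L → L → K) (N : L → L → Set L)
    (x y : L × L) : Prop :=
  x.1 < y.1 ∧ y.1 < x.2 ∧ ρ x.2 x.1 < ρ x.2 y.1 ∧ y.2 ∈ N x.2 y.1

/-- With columns c₁ < c₂ < c₃, z the height of x₀ and w that of x₁, row z gives ρ(c₃, c₂) < ρ(c₃,
c₁). Row w gives the opposite: ρ(c₃, c₁) ≤ max(ρ(w, c₁), ρ(w, c₃)) < ρ(w, c₂) ≤ ρ(c₃, c₂). -/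
theorem not_downEdge_clique_four {K L : Type u} [LinearOrder K] [LinearOrder L] (ρ : L → L → K)
    (h1 : ∀ a b c, a < b → b < c → ρ c a ≤ max (ρ b a) (ρ c b))
    (h2 : ∀ a b c, a < b → b < c → ρ b a ≤ max (ρ c a) (ρ c b)) (N : L → L → Set L)
    (hN : ∀ z b c d e, b < c → d ∈ N z b → e ∈ N z c → e ∈ N d c → ρ z c < ρ z b)
    {x₀ x₁ x₂ x₃ : L × L} (h01 : DownEdge ρ N x₀ x₁) (h02 : DownEdge ρ N x₀ x₂)
    (h03 : DownEdge ρ N x₀ x₃) (h12 : DownEdge ρ N x₁ x₂) (h13 : DownEdge ρ N x₁ x₃)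
    (h23 : DownEdge ρ N x₂ x₃) : False := by
  have t1 : ρ x₀.2 x₂.1 < ρ x₀.2 x₁.1 := hN _ _ _ _ _ h12.1 h01.2.2.2 h02.2.2.2 h12.2.2.2
  have t2 : ρ x₀.2 x₃.1 < ρ x₀.2 x₂.1 := hN _ _ _ _ _ h23.1 h02.2.2.2 h03.2.2.2 h23.2.2.2
  have t3 : ρ x₁.2 x₃.1 < ρ x₁.2 x₂.1 := hN _ _ _ _ _ h23.1 h12.2.2.2 h13.2.2.2 h23.2.2.2
  have a1 := h1 _ _ _ h13.1 h03.2.1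
  have a2 := h2 _ _ _ h23.1 h03.2.1
  have a3 := h2 _ _ _ h13.1 (h13.2.1)
  have a4 := h1 _ _ _ h23.1 (h13.2.1)
  have a5 := h12.2.2.1
  rcases le_max_iff.1 a1 with a | a
  · rcases le_max_iff.1 a2 with b | b <;> rcases le_max_iff.1 a3 with c | c <;>
      rcases le_max_iff.1 a4 with d | d <;> order
  · order

theorem mk_Iic_lt {κ : Cardinal.{u}} (hκ : ℵ₀ ≤ κ) {K : Type u} [PartialOrder K] {k : K}
    (h : #(Set.Iio k) < κ) : #(Set.Iic k) < κ := by
  rw [← Set.Iio_insert]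
  exact mk_insert_le.trans_lt (add_lt_of_lt hκ h (one_lt_aleph0.trans_le hκ))

/-! ### Edges inside κ large columns -/

theorem exists_downEdge {κ : Cardinal.{u}} (hκ : κ.IsRegular) {K L : Type u}
    [LinearOrder K] [LinearOrder L] [WellFoundedLT L]
    (hI : ∀ k : K, #(Set.Iic k) < κ) (hL : #L = Order.succ κ)
    (hIL : ∀ b : L, #(Set.Iic b) < Order.succ κ) (ρ : L → L → K)
    (h1 : ∀ a b c, a < b → b < c → ρ c a ≤ max (ρ b a) (ρ c b))
    (h2 : ∀ a b c, a < b → b < c → ρ b a ≤ max (ρ c a) (ρ c b))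
    (h3 : ∀ c k, #{a | a < c ∧ ρ c a ≤ k} < κ)
    (g : L → K → K) (gmono : ∀ z, Monotone (g z)) (gid : ∀ z n, n ≤ g z n)
    (hg : ∀ f : K → K, ∃ z₀, ∀ z ≥ z₀, #{n | f n < g z n} = κ)
    (S : L → Set L) (hS : ∀ c, #(S c) = κ)
    (hguess : ∀ y : Set L, κ < #y → ∃ c, S c ⊆ y)
    (N : L → L → Set L)
    (hN : ∀ z, ∀ c < z, ∀ a < z, ρ z a ≤ g z (ρ z c) → S a ⊆ Set.Iio z → (N z c ∩ S a).Nonempty)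
    (A : Set L) (hA : #A = κ) (X : L → Set L) (hX : ∀ a ∈ A, κ < #(X a)) :
    ∃ a ∈ A, ∃ b ∈ A, ∃ β ∈ X a, ∃ δ ∈ X b, DownEdge ρ N (a, β) (b, δ) := by
  have hreg : (Order.succ κ).IsRegular := isRegular_succ hκ.aleph0_le
  have hlt : κ < Order.succ κ := Order.lt_succ κ
  choose! γ hγ using fun a (ha : a ∈ A) => hguess (X a) (hX a ha)
  obtain ⟨s, hs⟩ : ∃ s, ∀ x ∈ A ∪ γ '' A ∪ ⋃ a ∈ A, S (γ a), x < s := by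
    refine exists_upper_bound_of_mk_lt hreg hL hIL ?_
    refine (mk_union_le _ _).trans_lt (add_lt_of_lt hreg.aleph0_le
      ((mk_union_le _ _).trans_lt (add_lt_of_lt hreg.aleph0_le ?_ ?_)) ?_)
    · rw [hA]; exact hlt
    · exact mk_image_le.trans_lt (by rw [hA]; exact hlt)
    · exact mk_biUnion_lt_of_isRegular hreg (by rw [hA]; exact hlt) fun a _ => by
        rw [hS]; exact hlt
  have hsA : ∀ a ∈ A, a < s := fun a ha => hs a (Or.inl (Or.inl ha))
  have hsγ : ∀ a ∈ A, γ a < s := fun a ha => hs _ (Or.inl (Or.inr ⟨a, ha, rfl⟩))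
  have hsS : ∀ a ∈ A, S (γ a) ⊆ Set.Iio s := fun a ha x hx => hs _ (Or.inr (by
    simp only [Set.mem_iUnion]; exact ⟨a, ha, hx⟩))
  -- Small fibres make ρ(s, ·) unbounded on the κ columns of `A`.
  have hbig : ∀ n, ∃ b ∈ A, n < ρ s b := by
    intro n
    by_contra! h
    refine ((mk_le_mk_of_subset fun b hb => ?_).trans_lt (h3 s n)).ne hA
    exact ⟨hsA b hb, h b hb⟩
  choose b hbA hb using hbig
  obtain ⟨z₀, hz₀⟩ := hg fun n => ρ s (γ (b n))
  have hAne : A.Nonempty := by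
    rw [← Set.nonempty_coe_sort, ← mk_ne_zero_iff, hA]; exact hκ.pos.ne'
  obtain ⟨a, haA, hamin⟩ := (wellFounded_lt (α := L)).has_min A hAne
  obtain ⟨β, hβX, hβ⟩ : ∃ β ∈ X a, max s z₀ < β := by
    by_contra! h
    exact ((mk_le_mk_of_subset (show X a ⊆ Set.Iic _ from h)).trans
      (Order.lt_succ_iff.1 (hIL _))).not_gt (hX a haA)
  have hsβ : s < β := (le_max_left _ _).trans_lt hβ
  -- With n above ρ(β, s), subadditivity transfers the estimates from row s to row β; with n above
  -- ρ(β, a), the edge from column a is allowed.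
  obtain ⟨n, hn, hn'⟩ : ∃ n, ρ s (γ (b n)) < g β n ∧ max (ρ β s) (ρ β a) < n := by
    by_contra! h
    exact ((mk_le_mk_of_subset (show {n | ρ s (γ (b n)) < g β n} ⊆ Set.Iic _ from h)).trans_lt
      (hI _)).ne (hz₀ β ((le_max_right _ _).trans hβ.le))
  obtain ⟨hns, hna⟩ := max_lt_iff.1 hn'
  have e1 : n < ρ β (b n) := by
    rcases le_max_iff.1 (h2 _ _ _ (hsA _ (hbA n)) hsβ) with h | h
    · exact (hb n).trans_le h
    · exact absurd (h.trans_lt (hns.trans (hb n))) (lt_irrefl _)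
  have e2 : ρ β (γ (b n)) ≤ g β (ρ β (b n)) := by
    refine (h1 _ _ _ (hsγ _ (hbA n)) hsβ).trans (max_le ?_ ?_)
    · exact hn.le.trans (gmono β e1.le)
    · exact (hns.trans e1).le.trans (gid β _)
  obtain ⟨δ, hδN, hδS⟩ := hN β (b n) ((hsA _ (hbA n)).trans hsβ) (γ (b n))
    ((hsγ _ (hbA n)).trans hsβ) e2 fun x hx => lt_trans (hsS _ (hbA n) hx) hsβ
  refine ⟨a, haA, b n, hbA n, β, hβX, δ, hγ _ (hbA n) hδS, ?_, (hsA _ (hbA n)).trans hsβ,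
    hna.trans e1, hδN⟩
  refine lt_of_le_of_ne (not_lt.1 (hamin _ (hbA n))) ?_
  rintro (h : a = b n)
  rw [← h] at e1
  exact (hna.trans e1).false

/-! ### Consequences of the cardinal hypotheses -/

theorem exists_monotone_majorant {κ : Cardinal.{u}} (hκ : κ.IsRegular) {K : Type u}
    [LinearOrder K] [WellFoundedLT K] (hK : #K = κ) (hI : ∀ k : K, #(Set.Iic k) < κ) (f : K → K) :
    ∃ g : K → K, Monotone g ∧ (∀ n, n ≤ g n) ∧ ∀ n, f n ≤ g n := by
  have h : ∀ n, ∃ x, (n ≤ x ∧ ∀ m ≤ n, f m ≤ x) ∧ ∀ y, (n ≤ y ∧ ∀ m ≤ n, f m ≤ y) → x ≤ y := by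
    intro n
    obtain ⟨x, hx⟩ := exists_upper_bound_of_mk_lt hκ hK hI
      (mk_image_le (f := f) (s := Set.Iic n) |>.trans_lt (hI n))
    obtain ⟨x, hx, hm⟩ := (wellFounded_lt (α := K)).has_min {x | n ≤ x ∧ ∀ m ≤ n, f m ≤ x}
      ⟨max n x, le_max_left _ _, fun m hm => le_max_of_le_right (hx _ ⟨m, hm, rfl⟩).le⟩
    exact ⟨x, hx, fun y hy => not_lt.1 (hm y hy)⟩
  choose g hg hmin using h
  exact ⟨g, fun i j hij => hmin i _ ⟨hij.trans (hg j).1, fun m hm => (hg j).2 m (hm.trans hij)⟩,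
    fun n => (hg n).1, fun n => (hg n).2 n le_rfl⟩

/-- Enumerate an unbounded family in type κ⁺; each initial segment has size below 𝔟, so one function
dominates it modulo fewer than κ points. -/
theorem exists_scale {κ : Cardinal.{u}} (hκ : κ.IsRegular)
    (hI : ∀ k : κ.ord.ToType, #(Set.Iic k) < κ) {L : Type u} [LinearOrder L]
    (hL : #L = Order.succ κ) (hIL : ∀ b : L, #(Set.Iic b) < Order.succ κ)
    (hb : Order.succ κ = unboundingNumber κ) :
    ∃ g : L → κ.ord.ToType → κ.ord.ToType, (∀ z, Monotone (g z)) ∧ (∀ z n, n ≤ g z n) ∧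
      ∀ f : κ.ord.ToType → κ.ord.ToType, ∃ z₀, ∀ z ≥ z₀, #{n | f n < g z n} = κ := by
  let C : Set Cardinal.{u} := {c | ∃ A : Set (κ.ord.ToType → κ.ord.ToType),
    (∀ f : κ.ord.ToType → κ.ord.ToType, ∃ g ∈ A, #{a : κ.ord.ToType | f a < g a} = κ) ∧ #A = c}
  have hC : sInf C = Order.succ κ := hb.symm
  -- An empty set of cardinals would have infimum 0.
  have hne : C.Nonempty := by
    by_contra h
    rw [Set.not_nonempty_iff_eq_empty] at h
    rw [h, Cardinal.sInf_empty] at hC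
    exact (Order.bot_lt_succ κ).ne hC
  obtain ⟨A, hA, hAc⟩ : Order.succ κ ∈ C := hC ▸ csInf_mem hne
  have hbdd : ∀ B : Set (κ.ord.ToType → κ.ord.ToType), #B < Order.succ κ →
      ∃ f : κ.ord.ToType → κ.ord.ToType, ∀ h ∈ B, #{a | f a < h a} < κ := by
    intro B hB
    by_contra! hcon
    refine (csInf_le' (show #B ∈ C from ⟨B, fun f => ?_, rfl⟩)).not_gt (hC ▸ hB)
    obtain ⟨h, hh, hle⟩ := hcon f
    exact ⟨h, hh, ((mk_set_le _).trans_eq (mk_ord_toType κ)).antisymm hle⟩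
  obtain ⟨e⟩ : Nonempty (L ≃ A) := by rw [← Cardinal.eq, hL, hAc]
  choose f hf using fun z : L => hbdd ((fun b => (e b).1) '' Set.Iic z)
    (mk_image_le.trans_lt (hIL z))
  choose g gmono gid gf using fun z =>
    exists_monotone_majorant hκ (mk_ord_toType κ) hI (f z)
  refine ⟨g, gmono, gid, fun φ => ?_⟩
  obtain ⟨h, hh, hc⟩ := hA φ
  refine ⟨e.symm ⟨h, hh⟩, fun z hz => ((mk_set_le _).trans_eq (mk_ord_toType κ)).antisymm ?_⟩
  have hsm : #{a | f z a < h a} < κ := hf z h ⟨e.symm ⟨h, hh⟩, hz, by simp⟩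
  have h1 := le_mk_sdiff_add_mk {a | φ a < h a} {a | f z a < h a}
  rw [hc] at h1
  by_contra! hlt
  refine h1.not_gt (add_lt_of_lt hκ.aleph0_le ((mk_le_mk_of_subset ?_).trans_lt hlt) hsm)
  rintro a ⟨h2, h3⟩
  exact h2.trans_le ((not_lt.1 h3).trans (gf z a))

theorem exists_stick_family {κ : Cardinal.{u}}
    (hs : Order.succ κ = stickNumber κ) :
    ∃ S : (Order.succ κ).ord.ToType → Set (Order.succ κ).ord.ToType, (∀ c, #(S c) = κ) ∧
      ∀ y : Set (Order.succ κ).ord.ToType, κ < #y → ∃ c, S c ⊆ y := by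
  let C : Set Cardinal.{u} := {c | ∃ X : Set (Set (Order.succ κ).ord.ToType),
    X ⊆ subsetsOfType (Order.succ κ).ord κ.ord ∧
    (∀ y ∈ subsetsOfType (Order.succ κ).ord (Order.succ κ).ord, ∃ x ∈ X, x ⊆ y) ∧ #X = c}
  have hC : sInf C = Order.succ κ := hs.symm
  have hne : C.Nonempty := by
    by_contra h
    rw [Set.not_nonempty_iff_eq_empty] at h
    rw [h, Cardinal.sInf_empty] at hC
    exact (Order.bot_lt_succ κ).ne hC
  obtain ⟨X, hX, hXy, hXc⟩ : Order.succ κ ∈ C := hC ▸ csInf_mem hne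
  obtain ⟨e⟩ : Nonempty ((Order.succ κ).ord.ToType ≃ X) := by
    rw [← Cardinal.eq, mk_ord_toType, hXc]
  refine ⟨fun c => (e c).1, fun c => ?_, fun y hy => ?_⟩
  · have h : typeLT (e c).1 = κ.ord := hX (e c).2
    rw [← Ordinal.card_type (· < · : (e c).1 → (e c).1 → Prop), h, card_ord]
  · have hy' : typeLT y = (Order.succ κ).ord := by
      apply le_antisymm
      · have : typeLT y ≤ typeLT (Order.succ κ).ord.ToType :=
          type_le_iff'.2 ⟨(OrderEmbedding.subtype (· ∈ y)).ltEmbedding⟩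
        exact this.trans_eq (type_toType _)
      · refine le_trans ?_ (ord_le_type (α := y) (· < ·))
        exact ord_le_ord.2 (Order.succ_le_of_lt hy)
    obtain ⟨x, hx, hxy⟩ := hXy y hy'
    exact ⟨e.symm ⟨x, hx⟩, by simpa using hxy⟩

/-! ### Copies of λκ and the colouring -/

theorem exists_downEdge_of_lex {κ : Cardinal.{u}} (hκ : κ.IsRegular) {K L : Type u}
    [LinearOrder K] [LinearOrder L] [WellFoundedLT L] (hK : #K = κ)
    (hI : ∀ k : K, #(Set.Iic k) < κ) (hL : #L = Order.succ κ)
    (hIL : ∀ b : L, #(Set.Iic b) < Order.succ κ) (D : L × L → L × L → Prop)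
    (hD : ∀ A : Set L, #A = κ → ∀ X : L → Set L, (∀ a ∈ A, κ < #(X a)) →
      ∃ a ∈ A, ∃ b ∈ A, ∃ β ∈ X a, ∃ δ ∈ X b, D (a, β) (b, δ))
    (E : K × L → K × L × L)
    (hE : ∀ x y, Prod.Lex (· < ·) (· < ·) x y →
      Prod.Lex (· < ·) (Prod.Lex (· < ·) (· < ·)) (E x) (E y))
    (k₀ : K) (hk₀ : ∀ x, (E x).1 ≤ k₀) :
    ∃ x y, (E x).1 = (E y).1 ∧ D (E x).2 (E y).2 := by
  have hlt : κ < Order.succ κ := Order.lt_succ κ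
  have hreg : (Order.succ κ).IsRegular := isRegular_succ hκ.aleph0_le
  have hne : Nonempty L := by rw [← mk_ne_zero_iff, hL]; exact hreg.pos.ne'
  have t₀ : L := hne.some
  have hmono : ∀ n n' t t', n < n' → (E (n, t)).1 ≤ (E (n', t')).1 := by
    intro n n' t t' h
    rcases Prod.lex_def.1 (hE (n, t) (n', t') (Prod.Lex.left _ _ h)) with h | h
    · exact h.le
    · exact h.1.le
  -- The layer is monotone in n and bounded by `k₀`, so by regularity it is constant from `n₀` on.
  obtain ⟨n₀, hn₀⟩ : ∃ n₀, ∀ v n t, v < (E (n, t)).1 → v < (E (n₀, t₀)).1 := by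
    have : ∀ v, ∃ m, ∀ n t, v < (E (n, t)).1 → ∃ t', v < (E (m, t')).1 := by
      intro v
      by_cases h : ∃ n t, v < (E (n, t)).1
      · obtain ⟨n, t, h⟩ := h
        exact ⟨n, fun _ _ _ => ⟨t, h⟩⟩
      · push Not at h
        exact ⟨k₀, fun n t h' => absurd h' (h n t).not_gt⟩
    choose m hm using this
    obtain ⟨n₀, h⟩ := exists_upper_bound_of_mk_lt hκ hK hI
      (mk_image_le (f := m) (s := Set.Iic k₀) |>.trans_lt (hI k₀))
    refine ⟨n₀, fun v n t hv => ?_⟩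
    obtain ⟨t', ht'⟩ := hm v n t hv
    exact ht'.trans_le (hmono _ _ _ _ (h _ ⟨v, hv.le.trans (hk₀ _), rfl⟩))
  have hconst : ∀ n, n₀ < n → ∀ t, (E (n, t)).1 = (E (n₀, t₀)).1 := fun n hn t =>
    le_antisymm (not_lt.1 fun h => (hn₀ _ n t h).false) (hmono _ _ _ _ hn)
  have hE' : ∀ n n' t t', n₀ < n → n₀ < n' → Prod.Lex (· < ·) (· < ·) (n, t) (n', t') →
      Prod.Lex (· < ·) (· < ·) (E (n, t)).2 (E (n', t')).2 := by
    intro n n' t t' hn hn' h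
    rcases Prod.lex_def.1 (hE _ _ h) with h | h
    · rw [hconst n hn, hconst n' hn'] at h
      exact absurd h (lt_irrefl _)
    · exact h.2
  -- A later copy bounds the columns of the nth, so its λ points fall into at most κ columns.
  have hcol : ∀ n, n₀ < n → ∃ c, κ < #{t | (E (n, t)).2.1 = c} := by
    intro n hn
    obtain ⟨n', hn'⟩ := exists_upper_bound_of_mk_lt hκ hK hI (hI n)
    have hlt' : n < n' := hn' n le_rfl
    have hle : ∀ t, (E (n, t)).2.1 ≤ (E (n', t₀)).2.1 := by
      intro t
      rcases Prod.lex_def.1 (hE' n n' t t₀ hn (hn.trans hlt') (Prod.Lex.left _ _ hlt')) with h | h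
      · exact h.le
      · exact h.1.le
    obtain ⟨c, hc⟩ := infinite_pigeonhole_card
      (fun t => (⟨(E (n, t)).2.1, hle t⟩ : Set.Iic (E (n', t₀)).2.1)) (Order.succ κ) hL.ge
      hreg.aleph0_le (by rw [hreg.cof_ord]; exact hIL _)
    refine ⟨c, hlt.trans_le (hc.trans (mk_le_mk_of_subset ?_))⟩
    intro t ht
    exact congrArg Subtype.val ht
  choose! c hc using hcol
  have hval : ∀ n, n₀ < n → κ < #{d | ∃ t, (E (n, t)).2 = (c n, d)} := by
    intro n hn
    refine (hc n hn).trans_le (mk_le_of_injective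
      (f := fun t => ⟨(E (n, t.1)).2.2, t.1, Prod.ext t.2 rfl⟩) ?_)
    rintro ⟨t, ht⟩ ⟨t', ht'⟩ h
    have h2 : (E (n, t)).2.2 = (E (n, t')).2.2 := congrArg Subtype.val h
    have h3 : (E (n, t)).2.1 = (E (n, t')).2.1 := Eq.trans ht (Eq.symm ht')
    refine Subtype.ext ?_
    rcases lt_trichotomy t t' with h4 | h4 | h4
    · rcases Prod.lex_def.1 (hE' n n t t' hn hn (Prod.Lex.right _ h4)) with h | h
      · exact absurd h3 h.ne
      · exact absurd h2 h.2.ne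
    · exact h4
    · rcases Prod.lex_def.1 (hE' n n t' t hn hn (Prod.Lex.right _ h4)) with h | h
      · exact absurd h3 h.ne'
      · exact absurd h2 h.2.ne'
  -- In a shared column, one height from copy n' would bound the more than κ heights from copy n.
  have hne : ∀ n n', n₀ < n → n < n' → c n ≠ c n' := by
    intro n n' hn hnn h
    obtain ⟨⟨d, t', ht'⟩⟩ : Nonempty {d | ∃ t, (E (n', t)).2 = (c n', d)} := by
      rw [← mk_ne_zero_iff]
      exact (bot_lt_of_lt (hval n' (hn.trans hnn))).ne'
    refine (hval n hn).not_ge ((mk_le_mk_of_subset ?_).trans (Order.lt_succ_iff.1 (hIL d)))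
    rintro e ⟨t, ht⟩
    have h1 := hE' n n' t t' hn (hn.trans hnn) (Prod.Lex.left _ _ hnn)
    rw [ht, ht', h] at h1
    rcases Prod.lex_def.1 h1 with h2 | h2
    · exact absurd h2 (lt_irrefl _)
    · exact h2.2.le
  have hinj : Set.InjOn c (Set.Ioi n₀) := by
    intro n hn n' hn' h
    rcases lt_trichotomy n n' with h4 | h4 | h4
    · exact absurd h (hne n n' hn h4)
    · exact h4
    · exact absurd h.symm (hne n' n hn' h4)
  have hA : #(c '' Set.Ioi n₀) = κ := by
    rw [mk_image_eq_of_injOn _ _ hinj]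
    have h1 := mk_sum_compl (Set.Iic n₀)
    rw [Set.compl_Iic, hK] at h1
    refine ((mk_set_le _).trans_eq hK).antisymm ?_
    by_contra! h
    exact (add_lt_of_lt hκ.aleph0_le (hI n₀) h).ne h1
  obtain ⟨a, -, b, -, β, ⟨n, hn, t, ht⟩, δ, ⟨n', hn', t', ht'⟩, hedge⟩ :=
    hD _ hA (fun a => {d | ∃ n, n₀ < n ∧ ∃ t, (E (n, t)).2 = (a, d)}) (by
      rintro _ ⟨n, hn, rfl⟩
      refine (hval n hn).trans_le (mk_le_mk_of_subset ?_)
      rintro d ⟨t, ht⟩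
      exact ⟨n, hn, t, ht⟩)
  refine ⟨(n, t), (n', t'), ?_, ?_⟩
  · rw [hconst n hn, hconst n' hn']
  · rw [ht, ht']
    exact hedge

theorem not_clique_of_type_four {K L : Type u} [LinearOrder K] [LinearOrder L] (ρ : L → L → K)
    (h1 : ∀ a b c, a < b → b < c → ρ c a ≤ max (ρ b a) (ρ c b))
    (h2 : ∀ a b c, a < b → b < c → ρ b a ≤ max (ρ c a) (ρ c b)) (N : L → L → Set L)
    (hN : ∀ z b c d e, b < c → d ∈ N z b → e ∈ N z c → e ∈ N d c → ρ z c < ρ z b)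
    {P : Type u} (q : P → L × L) (X : Set P) (hX : #X = 4)
    (hadj : ∀ x ∈ X, ∀ y ∈ X, x ≠ y → DownEdge ρ N (q x) (q y) ∨ DownEdge ρ N (q y) (q x)) :
    False := by
  obtain ⟨e⟩ : Nonempty (ULift.{u} (Fin 4) ≃ X) := by
    rw [← Cardinal.eq, hX]; simp
  let p : Fin 4 → P := fun i => (e ⟨i⟩).1
  have hp : ∀ i j, i ≠ j → DownEdge ρ N (q (p i)) (q (p j)) ∨ DownEdge ρ N (q (p j)) (q (p i)) :=
    fun i j hij => hadj _ (e ⟨i⟩).2 _ (e ⟨j⟩).2 fun h =>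
      hij (ULift.up_injective (e.injective (Subtype.ext h)))
  -- Edges increase the column, so sorting by column orients the whole clique.
  let σ := Tuple.sort fun i => (q (p i)).1
  have hσ : Monotone fun i => (q (p (σ i))).1 := Tuple.monotone_sort fun i => (q (p i)).1
  have hedge : ∀ i j, i < j → DownEdge ρ N (q (p (σ i))) (q (p (σ j))) := by
    intro i j hij
    rcases hp (σ i) (σ j) (σ.injective.ne hij.ne) with h | h
    · exact h
    · exact absurd h.1 (hσ hij.le).not_gt
  exact not_downEdge_clique_four ρ h1 h2 N hN (hedge 0 1 (by decide)) (hedge 0 2 (by decide))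
    (hedge 0 3 (by decide)) (hedge 1 2 (by decide)) (hedge 1 3 (by decide))
    (hedge 2 3 (by decide))

theorem exists_lex_embedding {κ lam : Cardinal.{u}} {α : Ordinal.{u}}
    (hα : α < lam.ord ^ (2 : ℕ) * κ.ord) :
    ∃ (ψ : α.ToType → κ.ord.ToType × lam.ord.ToType × lam.ord.ToType) (k₀ : κ.ord.ToType),
      (∀ x y, x < y → Prod.Lex (· < ·) (Prod.Lex (· < ·) (· < ·)) (ψ x) (ψ y)) ∧
      ∀ x, (ψ x).1 ≤ k₀ := by
  have h1 : lam.ord ^ (2 : ℕ) * κ.ord =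
      type (Prod.Lex (· < · : κ.ord.ToType → κ.ord.ToType → Prop)
        (Prod.Lex (· < · : lam.ord.ToType → lam.ord.ToType → Prop)
          (· < · : lam.ord.ToType → lam.ord.ToType → Prop))) := by
    rw [type_prod_lex, type_prod_lex, type_toType, type_toType, pow_two]
  rw [h1, ← type_toType α, type_lt_iff] at hα
  obtain ⟨f⟩ := hα
  refine ⟨f, f.top.1, fun x y h => f.map_rel_iff.2 h, fun x => ?_⟩
  rcases Prod.lex_def.1 (f.lt_top x) with h | h
  · exact h.le
  · exact h.1.le

theorem mk_Iio_ord_toType_lt {c : Cardinal.{u}} (i : c.ord.ToType) : #(Set.Iio i) < c := by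
  simpa using mk_Iio_lt i (by simp)

theorem not_partitionRel_mul_four {κ : Cardinal.{u}} (hκ : κ.IsRegular)
    (hb : Order.succ κ = unboundingNumber κ) (hs : Order.succ κ = stickNumber κ)
    {α : Ordinal.{u}} (hα : α < (Order.succ κ).ord ^ (2 : ℕ) * κ.ord) :
    ¬ PartitionRel α 2 ![(Order.succ κ).ord * κ.ord, 4] := by
  classical
  have hreg : (Order.succ κ).IsRegular := isRegular_succ hκ.aleph0_le
  have hI : ∀ k : κ.ord.ToType, #(Set.Iic k) < κ := fun k =>
    mk_Iic_lt hκ.aleph0_le (mk_Iio_ord_toType_lt k)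
  have hIL : ∀ b : (Order.succ κ).ord.ToType, #(Set.Iic b) < Order.succ κ := fun b =>
    mk_Iic_lt hreg.aleph0_le (mk_Iio_ord_toType_lt b)
  have hL := mk_ord_toType (Order.succ κ)
  obtain ⟨ρ, h1, h2, h3⟩ := exists_subadditive hκ (mk_ord_toType κ) hI
    (L := (Order.succ κ).ord.ToType) fun b => Order.lt_succ_iff.1 (mk_Iio_ord_toType_lt b)
  obtain ⟨g, gmono, gid, hg⟩ := exists_scale hκ hI hL hIL hb
  obtain ⟨S, hS, hguess⟩ := exists_stick_family hs
  obtain ⟨N, hN, hNS⟩ := exists_neighbours hκ ρ h3 g S fun c => (hS c).ge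
  obtain ⟨ψ, k₀, hψ, hk₀⟩ := exists_lex_embedding hα
  let R : α.ToType → α.ToType → Prop := fun x y =>
    (ψ x).1 = (ψ y).1 ∧ DownEdge ρ N (ψ x).2 (ψ y).2
  intro hpart
  obtain ⟨i, X, hX, hhom⟩ := hpart fun s => if ∃ x ∈ s.1, ∃ y ∈ s.1, R x y then 1 else 0
  have hR : ∀ x y, R x y → x ≠ y := by
    rintro x y h rfl
    exact h.2.1.false
  fin_cases i
  · have hX' : typeLT X = (Order.succ κ).ord * κ.ord := hX
    rw [← type_toType (Order.succ κ).ord, ← type_toType κ.ord, ← type_prod_lex, type_eq] at hX'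
    obtain ⟨φ⟩ := hX'
    obtain ⟨x, y, hxy⟩ := exists_downEdge_of_lex hκ (mk_ord_toType κ) hI hL hIL (DownEdge ρ N)
      (exists_downEdge hκ hI hL hIL ρ h1 h2 h3 g gmono gid hg S hS hguess N hNS)
      (fun x => ψ (φ.symm x).1) (fun x y h => hψ _ _ (φ.symm.map_rel_iff.2 h)) k₀
      fun x => hk₀ _
    have hxy' : R (φ.symm x).1 (φ.symm y).1 := hxy
    have := hhom ⟨{(φ.symm x).1, (φ.symm y).1}, Finset.card_pair (hR _ _ hxy')⟩ (by
      simp [Set.insert_subset_iff])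
    rw [if_pos ⟨_, by simp, _, by simp, hxy'⟩] at this
    simp at this
  · have hX' : typeLT X = 4 := hX
    refine not_clique_of_type_four ρ h1 h2 N hN (fun x => (ψ x).2) X ?_ ?_
    · rw [← Ordinal.card_type (· < · : X → X → Prop), hX']
      exact card_ofNat 4
    · intro x hx y hy hne
      have := hhom ⟨{x, y}, Finset.card_pair hne⟩ (by simp [Set.insert_subset_iff, hx, hy])
      by_contra! hcon
      rw [if_neg] at this
      · simp at this
      · simp only [Finset.mem_insert, Finset.mem_singleton]
        rintro ⟨a, rfl | rfl, b, rfl | rfl, h⟩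
        · exact hR _ _ h rfl
        · exact hcon.1 h.2
        · exact hcon.2 h.2
        · exact hR _ _ h rfl

theorem mainTheorem11 :
    (∀ κ lam : Cardinal.{u}, κ.IsRegular → lam = Order.succ κ → lam = unboundingNumber κ →
      lam = stickNumber κ →
      ∀ α : Ordinal.{u}, α < lam.ord ^ (2 : ℕ) * κ.ord →
        ¬ PartitionRel α 2 ![lam.ord * κ.ord, 4]) ∧
    (unboundingNumber (ℵ₀ : Cardinal.{u}) = ℵ_ 1 → ℵ_ 1 = stickNumber (ℵ₀ : Cardinal.{u}) →
      ∀ α : Ordinal.{u}, α < (ω_ 1) ^ (2 : ℕ) * ω →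
        ¬ PartitionRel α 2 ![ω_ 1 * ω, 4]) := by
  refine ⟨?_, ?_⟩
  · rintro κ lam hκ rfl hb hs α hα
    exact not_partitionRel_mul_four hκ hb hs hα
  · intro hb hs α hα
    rw [← succ_aleph0] at hb hs
    rw [← ord_aleph, ← succ_aleph0, ← ord_aleph0] at hα ⊢
    exact not_partitionRel_mul_four isRegular_aleph0 hb.symm hs hα
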